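/- All logarithms are to base $2$, all alphabets are finite. The Blackwell broadcast channel is the deterministic memoryless channel with input $X\in\{0,1,2\}$ and outputs $(Y_1,Y_2)=(0,0),(0,1),(1,1)$ for $X=0,1,2$, respectively. The (uncorrected) Han–Costa region of a broadcast channel is the set of triples $(R_0,R_1,R_2)$ of non-negative reals for which there are finite-valued random variables $W,U,V,X$, with $WUV-X-Y_1Y_2$ a Markov chain and $Y_1Y_2$ produced from $X$ by the channel, such that $$R_0+R_1<I(WU;Y_1),\qquad R_0+R_2<I(WV;Y_2),$$ $$R_0+R_1+R_2<\min\{I(W;Y_1),I(W;Y_2)\}+I(U;Y_1|W)+I(V;Y_2|W)-I(U;V|W).$$ A triple is achievable if for all $\lambda\in(0,1)$ and $\delta>0$ and all sufficiently large $n$ there is a code of length $n$ for a common message of rate at least $R_0-\delta$ and private messages of rates at least $R_1-\delta$, $R_2-\delta$ (independent and uniform) such that each receiver recovers the common message and its own private message with error probability at most $\lambda$. A source $(S,T)$ is admissible if for every $\lambda\in(0,1)$ and all sufficiently large $n$ there is a code of length $n$ by which receiver 1 recovers $S^n$ and receiver 2 recovers $T^n$, each with error probability at most $\lambda$, where $(S^n,T^n)$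 are $n$ i.i.d. copies of $(S,T)$. For an input law $p$ of the Blackwell channel let $Y_1,Y_2$ be the outputs when $X\sim p$, and put $$R_0=I(Y_1;Y_2)-\varepsilon,\qquad R_1=H(Y_1|Y_2),\qquad R_2=H(Y_2|Y_1).$$ (i) For every input law $p$ and every $\varepsilon$ with $0<\varepsilon\le I(Y_1;Y_2)$, the triple $(R_0,R_1,R_2)$ lies in the Han–Costa region of the Blackwell channel. (ii) Let $X$ be uniform on $\{0,1,2\}$. There is $\varepsilon_0$ with $0<\varepsilon_0\le I(Y_1;Y_2)$ such that for all $0<\varepsilon<\varepsilon_0$ the triple $(R_0,R_1,R_2)$ lies in the Han–Costa region but is not achievable. Moreover, for each such $\varepsilon$ there are sources $S=(S_0,K)$, $T=(T_0,K)$ with $K,S_0,T_0$ independent and $H(K)=R_0$, $H(S_0)=R_1$, $H(T_0)=R_2$, and no such source is admissible for the Blackwell channel. So the uncorrected Han–Costa region contains non-admissible sources. -/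

import Mathlib

/-! Finite probability spaces are finite types `Ω` with a weight function `p ∈ stdSimplex ℝ Ω`,
and random variables are functions on `Ω`. All logarithms are to base 2. -/

noncomputable section

namespace BC

/-! ### Entropy and mutual information -/

open Classical in
/-- The law of the random variable `f` on the finite probability space `(Ω, p)`. -/
def law {Ω A : Type*} [Fintype Ω] (p : Ω → ℝ) (f : Ω → A) (a : A) : ℝ :=
  ∑ ω, if f ω = a then p ω else 0

/-- Shannon entropy, in bits, of a weight function (with `0 log 0 = 0`). -/
def entropy {A : Type*} [Fintype A] (p : A → ℝ) : ℝ :=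
  ∑ a, -(p a * Real.logb 2 (p a))

/-- `H(f)`. -/
def ent {Ω A : Type*} [Fintype Ω] [Fintype A] (p : Ω → ℝ) (f : Ω → A) : ℝ :=
  entropy (law p f)

/-- `H(f | g)`. -/
def condEnt {Ω A B : Type*} [Fintype Ω] [Fintype A] [Fintype B]
    (p : Ω → ℝ) (f : Ω → A) (g : Ω → B) : ℝ :=
  ent p (fun ω => (f ω, g ω)) - ent p g

/-- `I(f ; g)`. -/
def mutInfo {Ω A B : Type*} [Fintype Ω] [Fintype A] [Fintype B]
    (p : Ω → ℝ) (f : Ω → A) (g : Ω → B) : ℝ :=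
  ent p f - condEnt p f g

/-- `I(f ; g | h)`. -/
def condMutInfo {Ω A B C : Type*} [Fintype Ω] [Fintype A] [Fintype B] [Fintype C]
    (p : Ω → ℝ) (f : Ω → A) (g : Ω → B) (h : Ω → C) : ℝ :=
  condEnt p f h - condEnt p f (fun ω => (g ω, h ω))

/-! ### Broadcast channels -/

/-- A discrete memoryless two-receiver broadcast channel with finite alphabets: `prob x (y₁, y₂)`
is the probability that the outputs are `y₁` and `y₂` when the input is `x`. -/
structure Channel (X Y₁ Y₂ : Type*) [Fintype Y₁] [Fintype Y₂] where
  prob : X → Y₁ × Y₂ → ℝ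
  prob_mem : ∀ x, prob x ∈ stdSimplex ℝ (Y₁ × Y₂)

/-- Transition probabilities of `n` uses of the channel without memory. -/
def Channel.probN {X Y₁ Y₂ : Type*} [Fintype Y₁] [Fintype Y₂] (c : Channel X Y₁ Y₂) {n : ℕ}
    (x : Fin n → X) (y₁ : Fin n → Y₁) (y₂ : Fin n → Y₂) : ℝ :=
  ∏ i, c.prob (x i) (y₁ i, y₂ i)

/-- The first output of the Blackwell channel: `0, 0, 1` on the inputs `0, 1, 2`. -/
def blackwell₁ : Fin 3 → Fin 2 := ![0, 0, 1]

/-- The second output of the Blackwell channel: `0, 1, 1` on the inputs `0, 1, 2`. -/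
def blackwell₂ : Fin 3 → Fin 2 := ![0, 1, 1]

/-- The (deterministic) Blackwell channel: `0 ↦ (0, 0)`, `1 ↦ (0, 1)`, `2 ↦ (1, 1)`. -/
def blackwell : Channel (Fin 3) (Fin 2) (Fin 2) where
  prob x y := if y = (blackwell₁ x, blackwell₂ x) then 1 else 0
  prob_mem x := by
    refine ⟨fun y => ?_, by simp⟩
    dsimp only
    split_ifs <;> norm_num

/-! ### The region without the fourth inequality -/

/-- The joint law of `((W, U, V, X), (Y₁, Y₂))` when `(W, U, V, X)` has law `q` and
`WUV - X - Y₁Y₂` is a Markov chain with `Y₁Y₂` produced from `X` by the channel. -/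
def auxLaw {X Y₁ Y₂ W U V : Type*} [Fintype Y₁] [Fintype Y₂] (c : Channel X Y₁ Y₂)
    (q : W × U × V × X → ℝ) : (W × U × V × X) × (Y₁ × Y₂) → ℝ :=
  fun z => q z.1 * c.prob z.1.2.2.2 z.2

/-- The Han-Costa rate region: the triples `(R₀, R₁, R₂)` of nonnegative reals for which there are
finite-valued `W, U, V, X` with `WUV - X - Y₁Y₂` such that
`R₀ + R₁ < I(WU; Y₁)`, `R₀ + R₂ < I(WV; Y₂)` and
`R₀ + R₁ + R₂ < min {I(W; Y₁), I(W; Y₂)} + I(U; Y₁ | W) + I(V; Y₂ | W) - I(U; V | W)`. -/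
def hanCostaRegion {X Y₁ Y₂ : Type*} [Fintype X] [Fintype Y₁] [Fintype Y₂]
    (c : Channel X Y₁ Y₂) : Set (ℝ × ℝ × ℝ) :=
  {R | 0 ≤ R.1 ∧ 0 ≤ R.2.1 ∧ 0 ≤ R.2.2 ∧
    ∃ (W U V : Type) (_ : Fintype W) (_ : Fintype U) (_ : Fintype V)
      (q : W × U × V × X → ℝ),
      q ∈ stdSimplex ℝ (W × U × V × X) ∧
      (let P := auxLaw c q
       let w : (W × U × V × X) × (Y₁ × Y₂) → W := fun z => z.1.1
       let u : (W × U × V × X) × (Y₁ × Y₂) → U := fun z => z.1.2.1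
       let v : (W × U × V × X) × (Y₁ × Y₂) → V := fun z => z.1.2.2.1
       let y₁ : (W × U × V × X) × (Y₁ × Y₂) → Y₁ := fun z => z.2.1
       let y₂ : (W × U × V × X) × (Y₁ × Y₂) → Y₂ := fun z => z.2.2
       R.1 + R.2.1 < mutInfo P (fun z => (w z, u z)) y₁ ∧
       R.1 + R.2.2 < mutInfo P (fun z => (w z, v z)) y₂ ∧
       R.1 + R.2.1 + R.2.2 <
         min (mutInfo P w y₁) (mutInfo P w y₂) + condMutInfo P u y₁ w + condMutInfo P v y₂ w
           - condMutInfo P u v w)}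

/-! ### Achievable rates and admissible sources -/

open Classical in
/-- Error probability of the first receiver, which has to recover the common message `m₀` and its
private message `m₁`, when the messages are independent and uniform. -/
def rateErr₁ {X Y₁ Y₂ : Type*} [Fintype Y₁] [Fintype Y₂] (c : Channel X Y₁ Y₂)
    {n M₀ M₁ M₂ : ℕ} (enc : Fin M₀ → Fin M₁ → Fin M₂ → Fin n → X)
    (dec : (Fin n → Y₁) → Fin M₀ × Fin M₁) : ℝ :=
  (∑ m₀, ∑ m₁, ∑ m₂, ∑ y₁ : Fin n → Y₁, ∑ y₂ : Fin n → Y₂,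
    if dec y₁ = (m₀, m₁) then 0 else c.probN (enc m₀ m₁ m₂) y₁ y₂) / (M₀ * M₁ * M₂)

open Classical in
/-- Error probability of the second receiver, which has to recover `m₀` and `m₂`. -/
def rateErr₂ {X Y₁ Y₂ : Type*} [Fintype Y₁] [Fintype Y₂] (c : Channel X Y₁ Y₂)
    {n M₀ M₁ M₂ : ℕ} (enc : Fin M₀ → Fin M₁ → Fin M₂ → Fin n → X)
    (dec : (Fin n → Y₂) → Fin M₀ × Fin M₂) : ℝ :=
  (∑ m₀, ∑ m₁, ∑ m₂, ∑ y₁ : Fin n → Y₁, ∑ y₂ : Fin n → Y₂,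
    if dec y₂ = (m₀, m₂) then 0 else c.probN (enc m₀ m₁ m₂) y₁ y₂) / (M₀ * M₁ * M₂)

/-- `(R₀, R₁, R₂)` is achievable: for all `λ ∈ (0, 1)` and `δ > 0` and all large enough `n` there is
a code of length `n` with rates at least `R₀ - δ, R₁ - δ, R₂ - δ` (in bits per channel use) and
both error probabilities at most `λ`. -/
def Achievable {X Y₁ Y₂ : Type*} [Fintype Y₁] [Fintype Y₂] (c : Channel X Y₁ Y₂)
    (R : ℝ × ℝ × ℝ) : Prop :=
  ∀ lam : ℝ, 0 < lam → lam < 1 → ∀ δ : ℝ, 0 < δ → ∃ N : ℕ, ∀ n : ℕ, N ≤ n →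
    ∃ (M₀ M₁ M₂ : ℕ) (enc : Fin M₀ → Fin M₁ → Fin M₂ → Fin n → X)
      (dec₁ : (Fin n → Y₁) → Fin M₀ × Fin M₁) (dec₂ : (Fin n → Y₂) → Fin M₀ × Fin M₂),
      (2 : ℝ) ^ ((n : ℝ) * (R.1 - δ)) ≤ M₀ ∧
      (2 : ℝ) ^ ((n : ℝ) * (R.2.1 - δ)) ≤ M₁ ∧
      (2 : ℝ) ^ ((n : ℝ) * (R.2.2 - δ)) ≤ M₂ ∧
      rateErr₁ c enc dec₁ ≤ lam ∧ rateErr₂ c enc dec₂ ≤ lam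

open Classical in
/-- Probability that the first receiver does not recover `Sⁿ`, where `(Sⁿ, Tⁿ)` consists of `n`
independent copies of the source `(S, T)` with law `p`. -/
def sourceErr₁ {X Y₁ Y₂ S T : Type*} [Fintype Y₁] [Fintype Y₂] [Fintype S] [Fintype T]
    (c : Channel X Y₁ Y₂) (p : S × T → ℝ) {n : ℕ}
    (enc : (Fin n → S) → (Fin n → T) → Fin n → X) (dec : (Fin n → Y₁) → Fin n → S) : ℝ :=
  ∑ s : Fin n → S, ∑ t : Fin n → T, ∑ y₁ : Fin n → Y₁, ∑ y₂ : Fin n → Y₂,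
    if dec y₁ = s then 0 else (∏ i, p (s i, t i)) * c.probN (enc s t) y₁ y₂

open Classical in
/-- Probability that the second receiver does not recover `Tⁿ`. -/
def sourceErr₂ {X Y₁ Y₂ S T : Type*} [Fintype Y₁] [Fintype Y₂] [Fintype S] [Fintype T]
    (c : Channel X Y₁ Y₂) (p : S × T → ℝ) {n : ℕ}
    (enc : (Fin n → S) → (Fin n → T) → Fin n → X) (dec : (Fin n → Y₂) → Fin n → T) : ℝ :=
  ∑ s : Fin n → S, ∑ t : Fin n → T, ∑ y₁ : Fin n → Y₁, ∑ y₂ : Fin n → Y₂,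
    if dec y₂ = t then 0 else (∏ i, p (s i, t i)) * c.probN (enc s t) y₁ y₂

/-- The source `(S, T)` with law `p` is admissible for the channel: for every `λ ∈ (0, 1)` and all
large enough `n` there is a code of length `n` with both error probabilities at most `λ`. -/
def Admissible {X Y₁ Y₂ S T : Type*} [Fintype Y₁] [Fintype Y₂] [Fintype S] [Fintype T]
    (c : Channel X Y₁ Y₂) (p : S × T → ℝ) : Prop :=
  ∀ lam : ℝ, 0 < lam → lam < 1 → ∃ N : ℕ, ∀ n : ℕ, N ≤ n →
    ∃ (enc : (Fin n → S) → (Fin n → T) → Fin n → X)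
      (dec₁ : (Fin n → Y₁) → Fin n → S) (dec₂ : (Fin n → Y₂) → Fin n → T),
      sourceErr₁ c p enc dec₁ ≤ lam ∧ sourceErr₂ c p enc dec₂ ≤ lam

open Classical in
/-- The law of the source `S = (S₀, K)`, `T = (T₀, K)` with `K, S₀, T₀` independent with laws
`pK, pS, pT`. -/
def commonSource {K S₀ T₀ : Type*} (pK : K → ℝ) (pS : S₀ → ℝ) (pT : T₀ → ℝ) :
    (S₀ × K) × (T₀ × K) → ℝ :=
  fun z => if z.1.2 = z.2.2 then pK z.1.2 * pS z.1.1 * pT z.2.1 else 0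

/-! ### The rate triple -/

/-- The joint law of `(X, (Y₁, Y₂))` when the channel input `X` has law `p`. -/
def ioLaw {X Y₁ Y₂ : Type*} [Fintype Y₁] [Fintype Y₂] (c : Channel X Y₁ Y₂) (p : X → ℝ) :
    X × (Y₁ × Y₂) → ℝ :=
  fun z => p z.1 * c.prob z.1 z.2

/-- `I(Y₁; Y₂)` for the channel input law `p`. -/
def outInfo {X Y₁ Y₂ : Type*} [Fintype X] [Fintype Y₁] [Fintype Y₂] (c : Channel X Y₁ Y₂)
    (p : X → ℝ) : ℝ :=
  mutInfo (ioLaw c p) (fun z => z.2.1) (fun z => z.2.2)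

/-- The triple `(I(Y₁; Y₂) - ε, H(Y₁ | Y₂), H(Y₂ | Y₁))` for the channel input law `p`. -/
def rateTriple {X Y₁ Y₂ : Type*} [Fintype X] [Fintype Y₁] [Fintype Y₂] (c : Channel X Y₁ Y₂)
    (p : X → ℝ) (ε : ℝ) : ℝ × ℝ × ℝ :=
  (outInfo c p - ε,
    condEnt (ioLaw c p) (fun z => z.2.1) (fun z => z.2.2),
    condEnt (ioLaw c p) (fun z => z.2.2) (fun z => z.2.1))

/-- The uniform law on the three inputs of the Blackwell channel. -/
def unifInput : Fin 3 → ℝ := fun _ => 1 / 3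

end BC

end

namespace BC

/-! ### A counting inequality for the Blackwell channel -/

/-! Membership is entropy bookkeeping: with `W` constant, `U = Y₁` and `V = Y₂`, the three bounds
become `H(Y₁)`, `H(Y₂)` and `H(Y₁, Y₂)`, and the triple stays below each by exactly `ε`.

The triple fails to be achievable because the correlation of `Y₁` and `Y₂` cannot be turned into a
common message. The tool is hypercontractivity: for uniform `Xⁿ`, `P(Y₁ⁿ ∈ A, Y₂ⁿ ∈ B) ≤ P(A)^(2/3)
P(B)^(1/2)`, which is `blackwell_count` after normalization. The decoders partition each output
space by the decoded common message. For most messages, of probability about `2^(-nR₀)`, both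
decoding sets have probability at most a constant multiple of that, so at most about `3ⁿ
2^(-7nR₀/6)` inputs are decoded to the message by both receivers. These inputs must carry about
`2^(n(R₁+R₂))` private pairs, which forces `7/6 R₀ + R₁ + R₂ ≤ log 3` (`weighted_converse`,
`exists_forall_not_code`).

For uniform input the left side equals `log 3 + (I - 7ε)/6` with `I = I(Y₁; Y₂) > 0`, a
contradiction for `ε < I/7`. Weighted messages let one converse serve both uniform messages and
i.i.d. sources; for the latter, `tail_le_pow` bounds the atypically heavy sequences. -/

theorem blackwell_two_point {u v : ℝ} (hu : 0 ≤ u) (hv : 0 ≤ v) :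
    3 * (3 * u ^ 4 + 2 * u ^ 2 * v ^ 2 + v ^ 4) ^ 3 ≤ 8 * (2 * u ^ 3 + v ^ 3) ^ 4 := by
  have h1 : 0 ≤ 5 * v ^ 4 - 3 * u ^ 2 * v ^ 2 + 36 * u ^ 4 := by
    nlinarith [sq_nonneg (v ^ 2 - u ^ 2), sq_nonneg (u ^ 2), sq_nonneg (v ^ 2)]
  have h2 : 0 ≤ 72 * v ^ 4 - 21 * u ^ 2 * v ^ 2 + 47 * u ^ 4 := by
    nlinarith [sq_nonneg (v ^ 2 - u ^ 2), sq_nonneg (u ^ 2), sq_nonneg (v ^ 2)]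
  -- The difference of the two sides: equality at `u = v` gives the factor `(u - v) ^ 2`, and the
  -- only negative coefficients left sit in the two definite quadratic forms in `u ^ 2, v ^ 2`
  -- above.
  have h3 : 0 ≤ (u - v) ^ 2 * (v ^ 6 * (5 * v ^ 4 - 3 * u ^ 2 * v ^ 2 + 36 * u ^ 4)
      + u ^ 6 * (72 * v ^ 4 - 21 * u ^ 2 * v ^ 2 + 47 * u ^ 4)
      + (10 * u * v ^ 9 + 48 * u ^ 3 * v ^ 7 + 24 * u ^ 5 * v ^ 5 + 120 * u ^ 7 * v ^ 3
      + 94 * u ^ 9 * v)) := by positivity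
  linear_combination h3

/-- The single-letter hypercontractive inequality, in a form that tensorizes: `c` is the factor
accumulated over earlier letters, and the coefficients 2 and 1 count the letters giving each output.
-/
theorem blackwell_one_step {a₀ a₁ b₀ b₁ c N₀₀ N₀₁ N₁₁ : ℝ} (ha₀ : 0 ≤ a₀) (ha₁ : 0 ≤ a₁)
    (hb₀ : 0 ≤ b₀) (hb₁ : 0 ≤ b₁) (hc : 0 ≤ c) (h₀₀ : 0 ≤ N₀₀) (h₀₁ : 0 ≤ N₀₁) (h₁₁ : 0 ≤ N₁₁)
    (H₀₀ : c * N₀₀ ^ 6 ≤ a₀ ^ 4 * b₀ ^ 3) (H₀₁ : c * N₀₁ ^ 6 ≤ a₀ ^ 4 * b₁ ^ 3)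
    (H₁₁ : c * N₁₁ ^ 6 ≤ a₁ ^ 4 * b₁ ^ 3) :
    c * 3 * (N₀₀ + N₀₁ + N₁₁) ^ 6 ≤ (2 * a₀ + a₁) ^ 4 * (b₀ + 2 * b₁) ^ 3 := by
  -- Sixth, cube and square roots turn the hypotheses into `g * N ≤ u ^ 2 * s`, so that everything
  -- below is polynomial.
  have root : ∀ {x : ℝ} (k : ℕ), k ≠ 0 → 0 ≤ x → ∃ y, 0 ≤ y ∧ y ^ k = x := fun {x} k hk hx =>
    ⟨x ^ (k⁻¹ : ℝ), by positivity, Real.rpow_inv_natCast_pow hx hk⟩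
  obtain ⟨u, hu, rfl⟩ := root 3 (by norm_num) ha₀
  obtain ⟨v, hv, rfl⟩ := root 3 (by norm_num) ha₁
  obtain ⟨s, hs, rfl⟩ := root 2 (by norm_num) hb₀
  obtain ⟨t, ht, rfl⟩ := root 2 (by norm_num) hb₁
  obtain ⟨g, hg, rfl⟩ := root 6 (by norm_num) hc
  have step : ∀ {N u s : ℝ}, 0 ≤ u → 0 ≤ s → g ^ 6 * N ^ 6 ≤ (u ^ 3) ^ 4 * (s ^ 2) ^ 3 →
      g * N ≤ u ^ 2 * s := fun {N u s} hu hs h =>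
    le_of_pow_le_pow_left₀ (n := 6) (by norm_num) (by positivity)
      (by rw [mul_pow]; exact h.trans_eq (by ring))
  have hN : g * (N₀₀ + N₀₁ + N₁₁) ≤ u ^ 2 * s + (u ^ 2 + v ^ 2) * t := by
    linarith [step hu hs H₀₀, step hu ht H₀₁, step hv ht H₁₁]
  -- Cauchy–Schwarz with the weights 1 and 2 of `s ^ 2 + 2 * t ^ 2`; this eliminates the second
  -- receiver.
  have hsq : 2 * (g * (N₀₀ + N₀₁ + N₁₁)) ^ 2 ≤
      (3 * u ^ 4 + 2 * u ^ 2 * v ^ 2 + v ^ 4) * (s ^ 2 + 2 * t ^ 2) := by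
    have := pow_le_pow_left₀ (by positivity) hN 2
    nlinarith [sq_nonneg (2 * u ^ 2 * t - (u ^ 2 + v ^ 2) * s)]
  have hcube := pow_le_pow_left₀ (by positivity) hsq 3
  have h2 := mul_le_mul_of_nonneg_right (blackwell_two_point hu hv)
    (show 0 ≤ (s ^ 2 + 2 * t ^ 2) ^ 3 by positivity)
  rw [mul_pow _ (s ^ 2 + 2 * t ^ 2)] at hcube
  linear_combination (3 / 8) * hcube + (1 / 8) * h2

theorem card_filter_cons {α : Type*} [Fintype α] {n : ℕ} (P : (Fin (n + 1) → α) → Prop)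
    [DecidablePred P] :
    (Finset.univ.filter P).card =
      ∑ a, (Finset.univ.filter fun x : Fin n → α => P (Fin.cons a x)).card := by
  simp only [Finset.card_filter]
  rw [← (Fin.consEquiv fun _ => α).sum_comp, Fintype.sum_prod_type]
  rfl

open Classical in
-- Induction on `n`: fixing the first letter replaces `A` and `B` by their sections, and
-- `blackwell_one_step` recombines the three letters.
theorem blackwell_count (n : ℕ) (A B : Set (Fin n → Fin 2)) :
    (3 : ℝ) ^ n *
      ((Finset.univ.filter fun x : Fin n → Fin 3 =>
        blackwell₁ ∘ x ∈ A ∧ blackwell₂ ∘ x ∈ B).card : ℝ) ^ 6 ≤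
    ((Finset.univ.filter fun x : Fin n → Fin 3 => blackwell₁ ∘ x ∈ A).card : ℝ) ^ 4 *
    ((Finset.univ.filter fun x : Fin n → Fin 3 => blackwell₂ ∘ x ∈ B).card : ℝ) ^ 3 := by
  induction n with
  | zero =>
    have h₁ : ∀ x : Fin 0 → Fin 3, blackwell₁ ∘ x = Fin.elim0 := fun x => Subsingleton.elim _ _
    have h₂ : ∀ x : Fin 0 → Fin 3, blackwell₂ ∘ x = Fin.elim0 := fun x => Subsingleton.elim _ _
    simp only [h₁, h₂]
    by_cases hA : (Fin.elim0 : Fin 0 → Fin 2) ∈ A <;>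
      by_cases hB : (Fin.elim0 : Fin 0 → Fin 2) ∈ B <;> simp [hA, hB]
  | succ n ih =>
    rw [card_filter_cons, card_filter_cons, card_filter_cons]
    have hcons : ∀ (f : Fin 3 → Fin 2) (a : Fin 3) (x : Fin n → Fin 3),
        f ∘ (Fin.cons a x : Fin (n + 1) → Fin 3) = Fin.cons (f a) (f ∘ x) := fun f a x =>
      Fin.comp_cons f a x
    simp only [hcons, Fin.sum_univ_three]
    have e₀ : blackwell₁ 0 = 0 := rfl
    have e₁ : blackwell₁ 1 = 0 := rfl
    have e₂ : blackwell₁ 2 = 1 := rfl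
    have f₀ : blackwell₂ 0 = 0 := rfl
    have f₁ : blackwell₂ 1 = 1 := rfl
    have f₂ : blackwell₂ 2 = 1 := rfl
    rw [e₀, e₁, e₂, f₀, f₁, f₂]
    have key := fun i j : Fin 2 => ih {y | (Fin.cons i y : Fin (n + 1) → Fin 2) ∈ A}
      {y | (Fin.cons j y : Fin (n + 1) → Fin 2) ∈ B}
    simp only [Set.mem_ofPred_eq] at key
    have := blackwell_one_step (Nat.cast_nonneg _) (Nat.cast_nonneg _) (Nat.cast_nonneg _)
      (Nat.cast_nonneg _) (by positivity) (Nat.cast_nonneg _) (Nat.cast_nonneg _)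
      (Nat.cast_nonneg _) (key 0 0) (key 0 1) (key 1 1)
    push_cast
    rw [pow_succ]
    refine this.trans_eq ?_
    ring

/-! ### A converse for codes with weighted messages -/

open Classical in
theorem sum_card_fiber {n : ℕ} {K : Type*} [Fintype K] (f : (Fin n → Fin 3) → K) :
    ∑ k, ((Finset.univ.filter fun x => f x = k).card : ℝ) = 3 ^ n := by
  have := Finset.card_eq_sum_card_fiberwise (f := f) (s := Finset.univ) (t := Finset.univ)
    (fun _ _ => Finset.mem_coe.2 (Finset.mem_univ _))
  simp only [Finset.card_univ, Fintype.card_fun, Fintype.card_fin] at this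
  exact_mod_cast this.symm

open Classical in
-- A union bound. The terms on the right pay for decoding errors, for messages heavier than `q₀, q₁,
-- q₂`, for common messages whose decoding sets are too large (at most `2 / C`, since the sets of
-- each receiver are disjoint), and for the remaining correct triples, which are counted by `D`.
theorem weighted_converse {n : ℕ} {K S T : Type*} [Fintype K] [Fintype S] [Fintype T]
    {wK : K → ℝ} {wS : S → ℝ} {wT : T → ℝ}
    (hK : wK ∈ stdSimplex ℝ K) (hS : wS ∈ stdSimplex ℝ S) (hT : wT ∈ stdSimplex ℝ T)
    (enc : K → S → T → Fin n → Fin 3) (d₁ : (Fin n → Fin 2) → K × S)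
    (d₂ : (Fin n → Fin 2) → K × T) {q₀ q₁ q₂ lam τ C D : ℝ}
    (hq₁ : 0 ≤ q₁) (hq₂ : 0 ≤ q₂) (hC : 0 < C) (hD : 0 ≤ D)
    (hCD : (3 ^ n) ^ 6 * (C * q₀) ^ 7 ≤ D ^ 6)
    (h₁ : ∑ k, ∑ s, ∑ t,
      (if d₁ (blackwell₁ ∘ enc k s t) = (k, s) then 0 else wK k * wS s * wT t) ≤ lam)
    (h₂ : ∑ k, ∑ s, ∑ t,
      (if d₂ (blackwell₂ ∘ enc k s t) = (k, t) then 0 else wK k * wS s * wT t) ≤ lam)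
    (tK : ∑ k, (if q₀ < wK k then wK k else 0) ≤ τ)
    (tS : ∑ s, (if q₁ < wS s then wS s else 0) ≤ τ)
    (tT : ∑ t, (if q₂ < wT t then wT t else 0) ≤ τ) :
    1 ≤ 2 * lam + 3 * τ + 2 / C + q₁ * q₂ * D := by
  obtain ⟨pK, sK⟩ := hK
  obtain ⟨pS, sS⟩ := hS
  obtain ⟨pT, sT⟩ := hT
  set a : K → ℝ := fun k =>
    ((Finset.univ.filter fun x : Fin n → Fin 3 => (d₁ (blackwell₁ ∘ x)).1 = k).card : ℝ) / 3 ^ n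
    with ha
  set b : K → ℝ := fun k =>
    ((Finset.univ.filter fun x : Fin n → Fin 3 => (d₂ (blackwell₂ ∘ x)).1 = k).card : ℝ) / 3 ^ n
    with hb
  have a0 : ∀ k, 0 ≤ a k := fun k => by positivity
  have b0 : ∀ k, 0 ≤ b k := fun k => by positivity
  have sa : ∑ k, a k = 1 := by
    rw [← Finset.sum_div, sum_card_fiber (fun x => (d₁ (blackwell₁ ∘ x)).1)]
    exact div_self (by positivity)
  have sb : ∑ k, b k = 1 := by
    rw [← Finset.sum_div, sum_card_fiber (fun x => (d₂ (blackwell₂ ∘ x)).1)]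
    exact div_self (by positivity)
  let good : K → S → T → Prop := fun k s t =>
    d₁ (blackwell₁ ∘ enc k s t) = (k, s) ∧ d₂ (blackwell₂ ∘ enc k s t) = (k, t) ∧
      wK k ≤ q₀ ∧ a k ≤ C * wK k ∧ b k ≤ C * wK k
  -- Each triple is charged to the first cause that applies; a triple with none is `good`.
  have pw : ∀ k s t, wK k * wS s * wT t ≤
      (if d₁ (blackwell₁ ∘ enc k s t) = (k, s) then 0 else wK k * wS s * wT t) +
      (if d₂ (blackwell₂ ∘ enc k s t) = (k, t) then 0 else wK k * wS s * wT t) +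
      (if q₀ < wK k then wK k else 0) * wS s * wT t +
      wK k * (if q₁ < wS s then wS s else 0) * wT t +
      wK k * wS s * (if q₂ < wT t then wT t else 0) +
      (a k + b k) / C * wS s * wT t +
      wK k * (q₁ * q₂) * (if good k s t then 1 else 0) := by
    intro k s t
    have hk := pK k
    have hs := pS s
    have ht := pT t
    have hak := a0 k
    have hbk := b0 k
    have hab : 0 ≤ (a k + b k) / C * wS s * wT t := by positivity
    have e₁ : 0 ≤ (if d₁ (blackwell₁ ∘ enc k s t) = (k, s) then 0 else wK k * wS s * wT t) := by
      split_ifs <;> positivity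
    have e₂ : 0 ≤ (if d₂ (blackwell₂ ∘ enc k s t) = (k, t) then 0 else wK k * wS s * wT t) := by
      split_ifs <;> positivity
    have e₃ : 0 ≤ (if q₀ < wK k then wK k else 0) * wS s * wT t := by
      split_ifs <;> positivity
    have e₄ : 0 ≤ wK k * (if q₁ < wS s then wS s else 0) * wT t := by
      split_ifs <;> positivity
    have e₅ : 0 ≤ wK k * wS s * (if q₂ < wT t then wT t else 0) := by
      split_ifs <;> positivity
    have e₆ : 0 ≤ wK k * (q₁ * q₂) * (if good k s t then 1 else 0) := by
      split_ifs <;> positivity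
    by_cases c₁ : d₁ (blackwell₁ ∘ enc k s t) = (k, s)
    swap
    · rw [if_neg c₁] at *; linarith
    by_cases c₂ : d₂ (blackwell₂ ∘ enc k s t) = (k, t)
    swap
    · rw [if_neg c₂] at *; linarith
    by_cases c₃ : q₀ < wK k
    · rw [if_pos c₃] at *; linarith
    by_cases c₄ : q₁ < wS s
    · rw [if_pos c₄] at *; linarith
    by_cases c₅ : q₂ < wT t
    · rw [if_pos c₅] at *; linarith
    by_cases c₆ : C * wK k ≤ a k + b k
    · have : wK k ≤ (a k + b k) / C := by rw [le_div_iff₀ hC]; linarith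
      have : wK k * wS s * wT t ≤ (a k + b k) / C * wS s * wT t := by gcongr
      linarith
    have hg : good k s t := ⟨c₁, c₂, not_lt.1 c₃, by linarith, by linarith⟩
    rw [if_pos hg] at *
    have : wK k * wS s * wT t ≤ wK k * (q₁ * q₂) * 1 := by
      rw [mul_one, mul_assoc]
      have := not_lt.1 c₄
      have := not_lt.1 c₅
      gcongr
    linarith
  have cnt : ∀ k, ∑ s, ∑ t, (if good k s t then (1 : ℝ) else 0) ≤ D := by
    intro k
    by_cases hk : wK k ≤ q₀ ∧ a k ≤ C * wK k ∧ b k ≤ C * wK k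
    swap
    · have : ∀ s t, ¬ good k s t := fun s t h => hk h.2.2
      simpa [this] using hD
    obtain ⟨k₀, k₁, k₂⟩ := hk
    set N := (Finset.univ.filter fun x : Fin n → Fin 3 =>
        blackwell₁ ∘ x ∈ {y | (d₁ y).1 = k} ∧ blackwell₂ ∘ x ∈ {y | (d₂ y).1 = k}).card with hN
    have le : ∑ s, ∑ t, (if good k s t then (1 : ℝ) else 0) ≤ N := by
      rw [← Fintype.sum_prod_type (f := fun z : S × T => if good k z.1 z.2 then (1 : ℝ) else 0),
        Finset.sum_boole]
      norm_cast
      -- For fixed `k` the channel input determines both outputs, and correct decoding recovers `s`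
      -- and `t` from them, so `enc` is injective on good pairs.
      refine Finset.card_le_card_of_injOn (fun z => enc k z.1 z.2) ?_ ?_
      · rintro ⟨s, t⟩ h
        have h : good k s t := by simpa using h
        simp [h.1, h.2.1]
      · rintro ⟨s, t⟩ h ⟨s', t'⟩ h' e
        have h : good k s t := by simpa using h
        have h' : good k s' t' := by simpa using h'
        have e : enc k s t = enc k s' t' := e
        have i₁ := h.1
        have i₂ := h.2.1
        rw [e, h'.1] at i₁
        rw [e, h'.2.1] at i₂
        simp only [Prod.mk.injEq, true_and] at i₁ i₂ ⊢
        exact ⟨i₁.symm, i₂.symm⟩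
    -- The exponents 4 and 3 add up to 7: both decoding sets have normalized size at most `C * q₀`,
    -- whence the power 7 in `hCD`.
    refine le.trans (le_of_pow_le_pow_left₀ (n := 6) (by norm_num) hD (le_trans ?_ hCD))
    have main := blackwell_count n {y | (d₁ y).1 = k} {y | (d₂ y).1 = k}
    rw [← hN] at main
    have ea : ((Finset.univ.filter fun x : Fin n → Fin 3 =>
        blackwell₁ ∘ x ∈ {y | (d₁ y).1 = k}).card : ℝ) = 3 ^ n * a k := by
      rw [ha]; field_simp; rfl
    have eb : ((Finset.univ.filter fun x : Fin n → Fin 3 =>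
        blackwell₂ ∘ x ∈ {y | (d₂ y).1 = k}).card : ℝ) = 3 ^ n * b k := by
      rw [hb]; field_simp; rfl
    rw [ea, eb] at main
    have ka : a k ≤ C * q₀ := k₁.trans (by gcongr)
    have kb : b k ≤ C * q₀ := k₂.trans (by gcongr)
    have := a0 k
    have := b0 k
    have hCq : 0 ≤ C * q₀ := (a0 k).trans ka
    have h3 : (0 : ℝ) < 3 ^ n := by positivity
    have : (3 ^ n * a k) ^ 4 * (3 ^ n * b k) ^ 3 ≤
        (3 ^ n * (C * q₀)) ^ 4 * (3 ^ n * (C * q₀)) ^ 3 := by gcongr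
    refine le_of_mul_le_mul_left ((main.trans this).trans_eq ?_) h3
    ring
  have total := Finset.sum_le_sum fun k (_ : k ∈ Finset.univ) =>
    Finset.sum_le_sum fun s (_ : s ∈ Finset.univ) =>
      Finset.sum_le_sum fun t (_ : t ∈ Finset.univ) => pw k s t
  simp only [Finset.sum_add_distrib] at total
  have split : ∀ (f : K → ℝ) (g : S → ℝ) (h : T → ℝ),
      ∑ k, ∑ s, ∑ t, f k * g s * h t = (∑ k, f k) * (∑ s, g s) * ∑ t, h t := by
    intro f g h
    simp only [← Finset.mul_sum, ← Finset.sum_mul]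
  rw [split, split, split, split, split, sK, sS, sT, ← Finset.sum_div, Finset.sum_add_distrib,
    sa, sb] at total
  have last : ∑ k, ∑ s, ∑ t, wK k * (q₁ * q₂) * (if good k s t then (1 : ℝ) else 0) ≤
      q₁ * q₂ * D := by
    simp only [← Finset.mul_sum]
    calc _ ≤ ∑ k, wK k * (q₁ * q₂) * D := by
          refine Finset.sum_le_sum fun k _ => mul_le_mul_of_nonneg_left (cnt k) ?_
          have := pK k
          positivity
      _ = _ := by rw [← Finset.sum_mul, ← Finset.sum_mul, sK, one_mul]
  simp only [mul_one, one_mul, one_add_one_eq_two] at total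
  linarith

/-! ### Tails of product laws -/

open Classical in
-- Chernoff's bound for the information density: `g θ` is its exponential moment, with `g 0 = 1` and
-- `g' 0 = -δ log 2 < 0`, so some `θ > 0` gives `g θ < 1`. Letters of probability zero do no harm,
-- as a product above the threshold is positive.
theorem tail_le_pow {K : Type*} [Fintype K] {p : K → ℝ} (hp : p ∈ stdSimplex ℝ K) {δ : ℝ}
    (hδ : 0 < δ) : ∃ r : ℝ, 0 ≤ r ∧ r < 1 ∧ ∀ n : ℕ,
      ∑ k : Fin n → K, (if (2 : ℝ) ^ (-((n : ℝ) * (entropy p - δ))) < ∏ i, p (k i) then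
        ∏ i, p (k i) else 0) ≤ r ^ n := by
  obtain ⟨p0, p1⟩ := hp
  set c : ℝ := (entropy p - δ) * Real.log 2 with hc
  have l2 : 0 < Real.log 2 := Real.log_pos (by norm_num)
  let g : ℝ → ℝ := fun θ => ∑ a, p a * Real.exp (θ * (Real.log (p a) + c))
  have hg : HasDerivAt g (∑ a, p a * (Real.log (p a) + c)) 0 := by
    refine HasDerivAt.fun_sum fun a _ => ?_
    have := (((hasDerivAt_id (0 : ℝ)).mul_const (Real.log (p a) + c)).exp).const_mul (p a)
    simpa using this
  have hneg : ∑ a, p a * (Real.log (p a) + c) < 0 := by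
    have : ∑ a, p a * (Real.log (p a) + c) = -(δ * Real.log 2) := by
      simp only [mul_add, Finset.sum_add_distrib, ← Finset.sum_mul, p1, one_mul]
      have : ∑ a, p a * Real.log (p a) = -(entropy p * Real.log 2) := by
        rw [entropy, Finset.sum_mul, ← Finset.sum_neg_distrib]
        refine Finset.sum_congr rfl fun a _ => ?_
        rw [Real.logb]
        field_simp
      rw [this, hc]
      ring
    rw [this]
    have := mul_pos hδ l2
    linarith
  have g0 : g 0 = 1 := by simp [g, p1]
  obtain ⟨θ, hθ, hlt⟩ : ∃ θ : ℝ, 0 < θ ∧ g θ < 1 := by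
    have h1 : ∀ᶠ x in nhdsWithin (0 : ℝ) (Set.Ioi 0), slope g 0 x < 0 :=
      ((hasDerivAt_iff_tendsto_slope.1 hg).mono_left
        (nhdsWithin_mono _ fun x (hx : 0 < x) => ne_of_gt hx)).eventually (gt_mem_nhds hneg)
    obtain ⟨x, hx, hx0⟩ := (h1.and self_mem_nhdsWithin).exists
    have hx0 : 0 < x := hx0
    refine ⟨x, hx0, ?_⟩
    rw [slope_def_field, sub_zero, div_neg_iff] at hx
    rcases hx with hx | hx
    · linarith [hx.2]
    · linarith [hx.1]
  refine ⟨g θ, Finset.sum_nonneg fun a _ => mul_nonneg (p0 a) (Real.exp_pos _).le, hlt,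
    fun n => ?_⟩
  have : g θ ^ n = ∏ _i : Fin n, g θ := by simp
  rw [this, Fintype.prod_sum]
  refine Finset.sum_le_sum fun k _ => ?_
  have hP : 0 ≤ ∏ i, p (k i) := Finset.prod_nonneg fun i _ => p0 _
  rw [Finset.prod_mul_distrib, ← Real.exp_sum]
  split_ifs with h
  · refine le_mul_of_one_le_right hP (Real.one_le_exp ?_)
    have hpos : 0 < ∏ i, p (k i) := lt_trans (by positivity) h
    have hne : ∀ i ∈ Finset.univ, p (k i) ≠ 0 := Finset.prod_ne_zero_iff.1 hpos.ne'
    have hl := Real.log_lt_log (by positivity) h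
    rw [Real.log_rpow (by norm_num), Real.log_prod hne] at hl
    rw [← Finset.mul_sum, Finset.sum_add_distrib]
    refine mul_nonneg hθ.le ?_
    simp only [Finset.sum_const, Finset.card_univ, Fintype.card_fin, nsmul_eq_mul]
    rw [hc]
    linarith
  · exact mul_nonneg hP (Real.exp_pos _).le

open Classical in
theorem eventually_tail_le {K : Type*} [Fintype K] {p : K → ℝ} (hp : p ∈ stdSimplex ℝ K)
    {δ τ : ℝ} (hδ : 0 < δ) (hτ : 0 < τ) : ∀ᶠ n : ℕ in Filter.atTop,
      ∑ k : Fin n → K, (if (2 : ℝ) ^ (-((n : ℝ) * (entropy p - δ))) < ∏ i, p (k i) then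
        ∏ i, p (k i) else 0) ≤ τ := by
  obtain ⟨r, hr0, hr1, h⟩ := tail_le_pow hp hδ
  filter_upwards [(tendsto_pow_atTop_nhds_zero_of_lt_one hr0 hr1).eventually (gt_mem_nhds hτ)]
    with n hn
  exact (h n).trans hn.le

theorem prod_mem_stdSimplex {K : Type*} [Fintype K] {p : K → ℝ} (hp : p ∈ stdSimplex ℝ K)
    (n : ℕ) : (fun k : Fin n → K => ∏ i, p (k i)) ∈ stdSimplex ℝ (Fin n → K) :=
  ⟨fun _ => Finset.prod_nonneg fun _ _ => hp.1 _, by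
    rw [← Fintype.prod_sum (fun (_ : Fin n) => p)]
    simp [hp.2]⟩

/-! ### Asymptotic converse -/

open Classical in
theorem exists_forall_not_code {R₀ R₁ R₂ : ℝ} (h : Real.logb 2 3 < 7 / 6 * R₀ + R₁ + R₂) :
    ∃ δ : ℝ, 0 < δ ∧ ∃ N : ℕ, ∀ n : ℕ, N ≤ n → ∀ (K S T : Type) [Fintype K] [Fintype S]
      [Fintype T] (wK : K → ℝ) (wS : S → ℝ) (wT : T → ℝ) (enc : K → S → T → Fin n → Fin 3)
      (d₁ : (Fin n → Fin 2) → K × S) (d₂ : (Fin n → Fin 2) → K × T),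
      wK ∈ stdSimplex ℝ K → wS ∈ stdSimplex ℝ S → wT ∈ stdSimplex ℝ T →
      ∑ k, (if (2 : ℝ) ^ (-((n : ℝ) * (R₀ - δ))) < wK k then wK k else 0) ≤ 1 / 8 →
      ∑ s, (if (2 : ℝ) ^ (-((n : ℝ) * (R₁ - δ))) < wS s then wS s else 0) ≤ 1 / 8 →
      ∑ t, (if (2 : ℝ) ^ (-((n : ℝ) * (R₂ - δ))) < wT t then wT t else 0) ≤ 1 / 8 →
      ∑ k, ∑ s, ∑ t, (if d₁ (blackwell₁ ∘ enc k s t) = (k, s) then 0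
        else wK k * wS s * wT t) ≤ 1 / 8 →
      ∑ k, ∑ s, ∑ t, (if d₂ (blackwell₂ ∘ enc k s t) = (k, t) then 0
        else wK k * wS s * wT t) ≤ 1 / 8 → False := by
  set γ := (7 / 6 * R₀ + R₁ + R₂ - Real.logb 2 3) / 2 with hγ
  have γ0 : 0 < γ := by linarith
  -- The loss from `δ` is `(7/6 + 1 + 1) δ = 19/6 δ`; this choice spends half of the gap `2γ`.
  refine ⟨6 / 19 * γ, by positivity, ?_⟩
  have r1 : (2 : ℝ) ^ (-γ) < 1 := Real.rpow_lt_one_of_one_lt_of_neg (by norm_num) (by linarith)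
  have lim : Filter.Tendsto (fun n : ℕ => (8 : ℝ) ^ (7 / 6 : ℝ) * ((2 : ℝ) ^ (-γ)) ^ n)
      Filter.atTop (nhds 0) := by
    simpa using (tendsto_pow_atTop_nhds_zero_of_lt_one (by positivity) r1).const_mul
      ((8 : ℝ) ^ (7 / 6 : ℝ))
  obtain ⟨N, hN⟩ := Filter.eventually_atTop.1
    (lim.eventually (gt_mem_nhds (show (0 : ℝ) < 1 / 8 by norm_num)))
  refine ⟨N, fun n hn K S T _ _ _ wK wS wT enc d₁ d₂ hK hS hT tK tS tT h₁ h₂ => ?_⟩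
  set δ := 6 / 19 * γ
  set q₀ : ℝ := (2 : ℝ) ^ (-((n : ℝ) * (R₀ - δ))) with hq₀
  have q0 : 0 < q₀ := by positivity
  -- With `C = 8` the fixed terms sum to `2/8 + 3/8 + 2/8 = 7/8`, so the last term would have to
  -- stay at least `1/8`, although it tends to 0.
  have main := weighted_converse hK hS hT enc d₁ d₂ (C := 8)
    (D := 3 ^ n * (8 * q₀) ^ (7 / 6 : ℝ)) (by positivity) (by positivity) (by norm_num)
    (by positivity)
    (by
      rw [mul_pow ((3 : ℝ) ^ n), ← Real.rpow_mul_natCast (by positivity),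
        ← Real.rpow_natCast (8 * q₀) 7]
      norm_num) h₁ h₂ tK tS tT
  have e : (2 : ℝ) ^ (-((n : ℝ) * (R₁ - δ))) * (2 : ℝ) ^ (-((n : ℝ) * (R₂ - δ))) *
      (3 ^ n * (8 * q₀) ^ (7 / 6 : ℝ)) = (8 : ℝ) ^ (7 / 6 : ℝ) * ((2 : ℝ) ^ (-γ)) ^ n := by
    have h3 : (3 : ℝ) ^ n = 2 ^ (Real.logb 2 3 * n) := by
      rw [Real.rpow_mul (by norm_num), Real.rpow_logb (by norm_num) (by norm_num) (by norm_num),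
        Real.rpow_natCast]
    rw [Real.mul_rpow (by norm_num) q0.le, h3, hq₀, ← Real.rpow_mul (by norm_num),
      ← Real.rpow_mul_natCast (by norm_num), mul_left_comm ((2 : ℝ) ^ (Real.logb 2 3 * n)),
      mul_left_comm, ← Real.rpow_add (by norm_num), ← Real.rpow_add (by norm_num),
      ← Real.rpow_add (by norm_num)]
    congr 2
    simp only [δ, hγ]
    ring
  rw [e] at main
  linarith [hN n hn]

/-! ### Codes for the Blackwell channel -/

open Classical in
theorem blackwell_probN {n : ℕ} (x : Fin n → Fin 3) (y₁ y₂ : Fin n → Fin 2) :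
    blackwell.probN x y₁ y₂ =
      if y₁ = blackwell₁ ∘ x then (if y₂ = blackwell₂ ∘ x then 1 else 0) else 0 := by
  unfold Channel.probN blackwell
  simp only [Prod.mk.injEq]
  rw [Finset.prod_ite_zero, ← ite_and]
  simp [funext_iff, forall_and]

theorem blackwell_sum₁ {n : ℕ} (x : Fin n → Fin 3) (P : (Fin n → Fin 2) → Prop)
    [DecidablePred P] (w : ℝ) :
    ∑ y₁, ∑ y₂, (if P y₁ then 0 else w * blackwell.probN x y₁ y₂) =
      if P (blackwell₁ ∘ x) then 0 else w := by
  rw [Finset.sum_eq_single (blackwell₁ ∘ x) _ (by simp),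
    Finset.sum_eq_single (blackwell₂ ∘ x) _ (by simp)]
  · simp [blackwell_probN]
  · intro y _ hy; simp [blackwell_probN, hy]
  · intro y _ hy; simp [blackwell_probN, hy]

theorem blackwell_sum₂ {n : ℕ} (x : Fin n → Fin 3) (P : (Fin n → Fin 2) → Prop)
    [DecidablePred P] (w : ℝ) :
    ∑ y₁, ∑ y₂, (if P y₂ then 0 else w * blackwell.probN x y₁ y₂) =
      if P (blackwell₂ ∘ x) then 0 else w := by
  rw [Finset.sum_eq_single (blackwell₁ ∘ x) _ (by simp),
    Finset.sum_eq_single (blackwell₂ ∘ x) _ (by simp)]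
  · simp [blackwell_probN]
  · intro y _ hy; simp [blackwell_probN, hy]
  · intro y _ hy; simp [blackwell_probN, hy]

open Classical in
theorem uniform_tail {M : ℕ} {x : ℝ} (hM : (2 : ℝ) ^ x ≤ M) :
    (fun _ : Fin M => (1 : ℝ) / M) ∈ stdSimplex ℝ (Fin M) ∧
      ∑ _m : Fin M, (if (2 : ℝ) ^ (-x) < (1 : ℝ) / M then (1 : ℝ) / M else 0) ≤ 1 / 8 := by
  have hp : (0 : ℝ) < 2 ^ x := by positivity
  have hM0 : (0 : ℝ) < M := hp.trans_le hM
  refine ⟨⟨fun _ => by positivity, by simp [hM0.ne']⟩, ?_⟩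
  -- Uniform weights never exceed the threshold, so the tail is empty.
  have : ¬ (2 : ℝ) ^ (-x) < (1 : ℝ) / M := by
    rw [not_lt, Real.rpow_neg (by norm_num), one_div]
    exact inv_anti₀ hp hM
  simp only [if_neg this]
  norm_num

theorem not_achievable_blackwell {R : ℝ × ℝ × ℝ}
    (h : Real.logb 2 3 < 7 / 6 * R.1 + R.2.1 + R.2.2) : ¬ Achievable blackwell R := by
  classical
  intro hA
  obtain ⟨δ, hδ, N, hN⟩ := exists_forall_not_code h
  obtain ⟨N', hN'⟩ := hA (1 / 8) (by norm_num) (by norm_num) δ hδ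
  obtain ⟨M₀, M₁, M₂, enc, dec₁, dec₂, h₀, h₁, h₂, e₁, e₂⟩ := hN' (max N N') (le_max_right _ _)
  obtain ⟨s₀, t₀⟩ := uniform_tail h₀
  obtain ⟨s₁, t₁⟩ := uniform_tail h₁
  obtain ⟨s₂, t₂⟩ := uniform_tail h₂
  refine hN _ (le_max_left _ _) (Fin M₀) (Fin M₁) (Fin M₂) _ _ _ enc dec₁ dec₂ s₀ s₁ s₂ t₀ t₁ t₂
    ?_ ?_
  · refine le_trans (le_of_eq ?_) e₁
    have := fun x P [DecidablePred P] => blackwell_sum₁ (n := max N N') x P 1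
    simp only [one_mul] at this
    simp only [rateErr₁, this]
    simp only [Finset.sum_div]
    refine Finset.sum_congr rfl fun k _ => Finset.sum_congr rfl fun s _ =>
      Finset.sum_congr rfl fun t _ => ?_
    split_ifs
    · simp
    · field_simp
  · refine le_trans (le_of_eq ?_) e₂
    have := fun x P [DecidablePred P] => blackwell_sum₂ (n := max N N') x P 1
    simp only [one_mul] at this
    simp only [rateErr₂, this]
    simp only [Finset.sum_div]
    refine Finset.sum_congr rfl fun k _ => Finset.sum_congr rfl fun s _ =>
      Finset.sum_congr rfl fun t _ => ?_
    split_ifs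
    · simp
    · field_simp

open Classical in
/-- Sums against `n` copies of the source `((S₀, K), (T₀, K))`. -/
theorem sum_commonSource {n : ℕ} {K S₀ T₀ : Type*} [Fintype K] [Fintype S₀] [Fintype T₀]
    (pK : K → ℝ) (pS : S₀ → ℝ) (pT : T₀ → ℝ)
    (P : (Fin n → S₀ × K) → (Fin n → T₀ × K) → Prop) [∀ s t, Decidable (P s t)] :
    ∑ s, ∑ t, (if P s t then 0 else ∏ i, commonSource pK pS pT (s i, t i)) =
      ∑ k : Fin n → K, ∑ s : Fin n → S₀, ∑ t : Fin n → T₀,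
        (if P (fun i => (s i, k i)) (fun i => (t i, k i)) then 0 else
          (∏ i, pK (k i)) * (∏ i, pS (s i)) * ∏ i, pT (t i)) := by
  rw [← (Equiv.arrowProdEquivProdArrow (Fin n) (fun _ => S₀) (fun _ => K)).symm.sum_comp,
    Fintype.sum_prod_type, Finset.sum_comm]
  refine Finset.sum_congr rfl fun k _ => Finset.sum_congr rfl fun s _ => ?_
  rw [← (Equiv.arrowProdEquivProdArrow (Fin n) (fun _ => T₀) (fun _ => K)).symm.sum_comp,
    Fintype.sum_prod_type]
  refine Finset.sum_congr rfl fun t _ => ?_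
  -- Pairs whose `K`-components differ anywhere have weight zero, so only the diagonal survives.
  rw [Finset.sum_eq_single k _ (by simp)]
  · refine if_congr Iff.rfl rfl ?_
    simp [commonSource, Finset.prod_mul_distrib]
  · intro k' _ hk'
    obtain ⟨i, hi⟩ := Function.ne_iff.1 hk'
    have : ∏ i, commonSource pK pS pT
        ((Equiv.arrowProdEquivProdArrow (Fin n) (fun _ => S₀) (fun _ => K)).symm (s, k) i,
        (Equiv.arrowProdEquivProdArrow (Fin n) (fun _ => T₀) (fun _ => K)).symm (t, k') i) = 0 :=
      Finset.prod_eq_zero (Finset.mem_univ i) (if_neg (Ne.symm hi))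
    rw [this, ite_self]

theorem not_admissible_blackwell {K S₀ T₀ : Type} [Fintype K] [Fintype S₀] [Fintype T₀]
    {pK : K → ℝ} {pS : S₀ → ℝ} {pT : T₀ → ℝ} (hK : pK ∈ stdSimplex ℝ K)
    (hS : pS ∈ stdSimplex ℝ S₀) (hT : pT ∈ stdSimplex ℝ T₀)
    (h : Real.logb 2 3 < 7 / 6 * entropy pK + entropy pS + entropy pT) :
    ¬ Admissible blackwell (commonSource pK pS pT) := by
  classical
  intro hA
  obtain ⟨δ, hδ, N, hN⟩ := exists_forall_not_code h
  obtain ⟨N', hN'⟩ := hA (1 / 8) (by norm_num) (by norm_num)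
  have h8 : (0 : ℝ) < 1 / 8 := by norm_num
  obtain ⟨n, ⟨⟨tK, tS⟩, tT⟩, n₁, n₂⟩ := (((eventually_tail_le hK hδ h8).and
    (eventually_tail_le hS hδ h8)).and (eventually_tail_le hT hδ h8) |>.and
    ((Filter.eventually_ge_atTop N).and (Filter.eventually_ge_atTop N'))).exists
  obtain ⟨enc, dec₁, dec₂, e₁, e₂⟩ := hN' n n₂
  refine hN n n₁ (Fin n → K) (Fin n → S₀) (Fin n → T₀) _ _ _
    (fun k s t => enc (fun i => (s i, k i)) (fun i => (t i, k i)))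
    (fun y => (fun i => (dec₁ y i).2, fun i => (dec₁ y i).1))
    (fun y => (fun i => (dec₂ y i).2, fun i => (dec₂ y i).1))
    (prod_mem_stdSimplex hK n) (prod_mem_stdSimplex hS n) (prod_mem_stdSimplex hT n) tK tS tT ?_ ?_
  · refine le_trans (le_of_eq ?_) e₁
    have e : sourceErr₁ blackwell (commonSource pK pS pT) enc dec₁ = ∑ s, ∑ t,
        if dec₁ (blackwell₁ ∘ enc s t) = s then 0
          else ∏ i, commonSource pK pS pT (s i, t i) :=
      Finset.sum_congr rfl fun s _ => Finset.sum_congr rfl fun t _ => by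
        convert! blackwell_sum₁ (enc s t) (fun y => dec₁ y = s) _
    rw [e, sum_commonSource pK pS pT fun s t => dec₁ (blackwell₁ ∘ enc s t) = s]
    refine Finset.sum_congr rfl fun k _ => Finset.sum_congr rfl fun s _ =>
      Finset.sum_congr rfl fun t _ => ite_congr (propext ?_) (fun _ => rfl) fun _ => rfl
    simp only [Prod.ext_iff, funext_iff, forall_and]
    exact and_comm
  · refine le_trans (le_of_eq ?_) e₂
    have e : sourceErr₂ blackwell (commonSource pK pS pT) enc dec₂ = ∑ s, ∑ t,
        if dec₂ (blackwell₂ ∘ enc s t) = t then 0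
          else ∏ i, commonSource pK pS pT (s i, t i) :=
      Finset.sum_congr rfl fun s _ => Finset.sum_congr rfl fun t _ => by
        convert! blackwell_sum₂ (enc s t) (fun y => dec₂ y = t) _
    rw [e, sum_commonSource pK pS pT fun s t => dec₂ (blackwell₂ ∘ enc s t) = t]
    refine Finset.sum_congr rfl fun k _ => Finset.sum_congr rfl fun s _ =>
      Finset.sum_congr rfl fun t _ => ite_congr (propext ?_) (fun _ => rfl) fun _ => rfl
    simp only [Prod.ext_iff, funext_iff, forall_and]
    exact and_comm

/-! ### Entropies of push-forwards -/

theorem law_law {Ω Ω' A : Type*} [Fintype Ω] [Fintype Ω'] (p : Ω → ℝ) (φ : Ω → Ω') (f : Ω' → A) :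
    law (law p φ) f = law p (f ∘ φ) := by
  classical
  funext a
  simp only [law, Function.comp]
  simp_rw [← Finset.sum_filter]
  rw [Finset.sum_filter]
  simp_rw [Finset.sum_filter]
  calc _ = ∑ ω', ∑ ω, (if φ ω = ω' then (if f ω' = a then p ω else 0) else 0) := by
        refine Finset.sum_congr rfl fun ω' _ => ?_
        split_ifs <;> simp
    _ = _ := by
        rw [Finset.sum_comm]
        simp

theorem ent_law {Ω Ω' A : Type*} [Fintype Ω] [Fintype Ω'] [Fintype A] (p : Ω → ℝ) (φ : Ω → Ω')
    (f : Ω' → A) : ent (law p φ) f = ent p (f ∘ φ) := by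
  rw [ent, ent, law_law]

theorem ent_comp {Ω A B : Type*} [Fintype Ω] [Fintype A] [Fintype B] (p : Ω → ℝ) (f : Ω → A)
    {e : A → B} (he : Function.Injective e) : ent p (e ∘ f) = ent p f := by
  classical
  unfold ent entropy
  rw [← Finset.sum_subset (Finset.subset_univ (Finset.univ.image e)),
    Finset.sum_image he.injOn]
  · simp [law, he.eq_iff]
  · intro b _ hb
    have : ∀ a, e a ≠ b := by simpa using hb
    simp [law, this]

theorem ent_const {Ω A : Type*} [Fintype Ω] [Fintype A] {p : Ω → ℝ} (hp : ∑ ω, p ω = 1) (a : A) :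
    ent p (fun _ => a) = 0 := by
  classical
  unfold ent entropy
  refine Finset.sum_eq_zero fun b _ => ?_
  by_cases h : a = b <;> simp [law, h, hp]

/-! ### The three entropies of the Blackwell channel outputs -/

theorem ioLaw_blackwell (p : Fin 3 → ℝ) :
    ioLaw blackwell p = law p fun x => (x, (blackwell₁ x, blackwell₂ x)) := by
  classical
  funext ⟨x, y⟩
  simp only [ioLaw, blackwell, law]
  rw [Finset.sum_eq_single x]
  · simp [eq_comm]
  · intro x' _ h
    simp [h]
  · simp

theorem outInfo_blackwell (p : Fin 3 → ℝ) :
    outInfo blackwell p = ent p blackwell₁ + ent p blackwell₂ -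
      ent p fun x => (blackwell₁ x, blackwell₂ x) := by
  simp only [outInfo, mutInfo, condEnt, ioLaw_blackwell, ent_law, Function.comp_def]
  ring

theorem condEnt₁_blackwell (p : Fin 3 → ℝ) :
    condEnt (ioLaw blackwell p) (fun z => z.2.1) (fun z => z.2.2) =
      ent p (fun x => (blackwell₁ x, blackwell₂ x)) - ent p blackwell₂ := by
  simp only [condEnt, ioLaw_blackwell, ent_law, Function.comp_def]

theorem condEnt₂_blackwell (p : Fin 3 → ℝ) :
    condEnt (ioLaw blackwell p) (fun z => z.2.2) (fun z => z.2.1) =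
      ent p (fun x => (blackwell₁ x, blackwell₂ x)) - ent p blackwell₁ := by
  simp only [condEnt, ioLaw_blackwell, ent_law, Function.comp_def]
  rw [← ent_comp p (fun x => (blackwell₁ x, blackwell₂ x)) Prod.swap_injective]
  rfl

theorem ent_blackwell₁ (p : Fin 3 → ℝ) : ent p blackwell₁ =
    -((p 0 + p 1) * Real.logb 2 (p 0 + p 1)) - p 2 * Real.logb 2 (p 2) := by
  simp [ent, entropy, law, blackwell₁, Fin.sum_univ_succ]
  ring

theorem ent_blackwell₂ (p : Fin 3 → ℝ) : ent p blackwell₂ =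
    -(p 0 * Real.logb 2 (p 0)) - (p 1 + p 2) * Real.logb 2 (p 1 + p 2) := by
  simp [ent, entropy, law, blackwell₂, Fin.sum_univ_succ]
  ring

theorem ent_blackwell (p : Fin 3 → ℝ) : ent p (fun x => (blackwell₁ x, blackwell₂ x)) =
    -(p 0 * Real.logb 2 (p 0)) - p 1 * Real.logb 2 (p 1) - p 2 * Real.logb 2 (p 2) := by
  simp [ent, entropy, law, blackwell₁, blackwell₂, Fintype.sum_prod_type, Fin.sum_univ_succ]
  ring

/-- Merging two atoms does not increase entropy; this gives nonnegativity of `H(Y₁ | Y₂)` and `H(Y₂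
| Y₁)`. -/
theorem mul_logb_add_le {a b : ℝ} (ha : 0 ≤ a) (hb : 0 ≤ b) :
    a * Real.logb 2 a + b * Real.logb 2 b ≤ (a + b) * Real.logb 2 (a + b) := by
  have key : ∀ {x y : ℝ}, 0 ≤ x → 0 ≤ y → x * Real.logb 2 x ≤ x * Real.logb 2 (x + y) := by
    intro x y hx hy
    rcases hx.eq_or_lt with rfl | hx
    · simp
    · exact mul_le_mul_of_nonneg_left
        (Real.logb_le_logb_of_le (by norm_num) hx (by linarith)) hx.le
  have h₁ := key ha hb
  have h₂ := key hb ha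
  rw [add_comm b a] at h₂
  linarith

/-! ### The triple lies in the Han-Costa region -/

/-- The law of `(W, U, V, X)` with `W` constant, `U = Y₁` and `V = Y₂`. -/
noncomputable def outputAux (p : Fin 3 → ℝ) : Fin 1 × Fin 2 × Fin 2 × Fin 3 → ℝ :=
  law p fun x => (0, blackwell₁ x, blackwell₂ x, x)

theorem law_mem_stdSimplex {Ω A : Type*} [Fintype Ω] [Fintype A] {p : Ω → ℝ}
    (hp : p ∈ stdSimplex ℝ Ω) (f : Ω → A) : law p f ∈ stdSimplex ℝ A := by
  classical
  refine ⟨fun a => Finset.sum_nonneg fun ω _ => ?_, ?_⟩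
  · split_ifs
    exacts [hp.1 ω, le_rfl]
  · simp only [law]
    rw [Finset.sum_comm]
    simpa using hp.2

theorem auxLaw_outputAux (p : Fin 3 → ℝ) : auxLaw blackwell (outputAux p) =
    law p fun x => ((0, blackwell₁ x, blackwell₂ x, x), (blackwell₁ x, blackwell₂ x)) := by
  classical
  funext ⟨⟨w, u, v, x⟩, y⟩
  simp only [auxLaw, outputAux, blackwell, law]
  rw [Finset.sum_eq_single x, Finset.sum_eq_single x]
  · by_cases h : y = (blackwell₁ x, blackwell₂ x)
    · simp [h]
    · simp [h, Ne.symm h]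
  · intro x' _ h
    simp [h]
  · simp
  · intro x' _ h
    simp [h]
  · simp

theorem rateTriple_mem_hanCostaRegion {p : Fin 3 → ℝ} (hp : p ∈ stdSimplex ℝ (Fin 3)) {ε : ℝ}
    (hε : 0 < ε) (hεI : ε ≤ outInfo blackwell p) :
    rateTriple blackwell p ε ∈ hanCostaRegion blackwell := by
  obtain ⟨p0, p1⟩ := id hp
  have hw : ∀ f : Fin 3 → Fin 2, ent p (fun x => ((0 : Fin 1), f x)) = ent p f := fun f =>
    ent_comp p f (e := fun a => ((0 : Fin 1), a)) fun a b h => (Prod.mk.inj h).2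
  have hw' : ∀ f : Fin 3 → Fin 2, ent p (fun x => (f x, (0 : Fin 1))) = ent p f := fun f =>
    ent_comp p f (e := fun a => (a, (0 : Fin 1))) fun a b h => (Prod.mk.inj h).1
  have hwy : ∀ f : Fin 3 → Fin 2, ent p (fun x => (((0 : Fin 1), f x), f x)) = ent p f := fun f =>
    ent_comp p f (e := fun a => (((0 : Fin 1), a), a)) fun a b h => (Prod.mk.inj h).2
  have hyw : ∀ f : Fin 3 → Fin 2, ent p (fun x => (f x, (f x, (0 : Fin 1)))) = ent p f := fun f =>
    ent_comp p f (e := fun a => (a, (a, (0 : Fin 1)))) fun a b h => (Prod.mk.inj h).1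
  have huv : ent p (fun x => (blackwell₁ x, (blackwell₂ x, (0 : Fin 1)))) =
      ent p fun x => (blackwell₁ x, blackwell₂ x) :=
    ent_comp p (fun x => (blackwell₁ x, blackwell₂ x))
      (e := fun a => (a.1, (a.2, (0 : Fin 1)))) fun a b h => by
        simp only [Prod.mk.injEq, and_true] at h
        exact Prod.ext h.1 h.2
  have hc : ent p (fun _ => (0 : Fin 1)) = 0 := ent_const p1 0
  have hI := outInfo_blackwell p
  simp only [hanCostaRegion, rateTriple, Set.mem_ofPred_eq, condEnt₁_blackwell, condEnt₂_blackwell]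
  refine ⟨by linarith, ?_, ?_, Fin 1, Fin 2, Fin 2, inferInstance, inferInstance, inferInstance,
    outputAux p, law_mem_stdSimplex hp _, ?_⟩
  · rw [ent_blackwell, ent_blackwell₂]
    linarith [mul_logb_add_le (p0 1) (p0 2)]
  · rw [ent_blackwell, ent_blackwell₁]
    linarith [mul_logb_add_le (p0 0) (p0 1)]
  · simp only [mutInfo, condMutInfo, condEnt, auxLaw_outputAux, ent_law, Function.comp_def, hw, hw',
      hwy, hyw, huv, hc]
    refine ⟨by linarith, by linarith, ?_⟩
    simp only [sub_zero, sub_self, min_self]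
    linarith

/-! ### The uniform input -/

theorem logb_two_two_thirds : Real.logb 2 (2 / 3) = 1 - Real.logb 2 3 := by
  rw [Real.logb_div (by norm_num) (by norm_num), Real.logb_self_eq_one (by norm_num)]

theorem logb_two_one_third : Real.logb 2 (1 / 3) = -Real.logb 2 3 := by
  rw [one_div, Real.logb_inv]

theorem rateTriple_unifInput (ε : ℝ) :
    rateTriple blackwell unifInput ε = (Real.logb 2 3 - 4 / 3 - ε, 2 / 3, 2 / 3) := by
  have e : (1 / 3 + 1 / 3 : ℝ) = 2 / 3 := by norm_num
  simp only [rateTriple, condEnt₁_blackwell, condEnt₂_blackwell, outInfo_blackwell, ent_blackwell,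
    ent_blackwell₁, ent_blackwell₂, unifInput, e, logb_two_two_thirds, logb_two_one_third]
  ext <;> simp <;> ring

theorem outInfo_unifInput : outInfo blackwell unifInput = Real.logb 2 3 - 4 / 3 := by
  have := congrArg Prod.fst (rateTriple_unifInput 0)
  simpa [rateTriple] using this

theorem four_thirds_lt_logb : 4 / 3 < Real.logb 2 3 := by
  rw [Real.lt_logb_iff_rpow_lt (by norm_num) (by norm_num)]
  -- After cubing, the claim is `16 < 27`.
  refine lt_of_pow_lt_pow_left₀ 3 (by norm_num) ?_
  rw [← Real.rpow_mul_natCast (by norm_num)]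
  norm_num

theorem logb_two_three_lt : Real.logb 2 3 < 2 := by
  rw [Real.logb_lt_iff_lt_rpow (by norm_num) (by norm_num)]
  norm_num

/-- Binary entropy runs continuously from 0 to 1 bit on `[0, 1/2]`, so the intermediate value
theorem applies. -/
theorem exists_entropy_eq {h : ℝ} (h0 : 0 ≤ h) (h1 : h ≤ 1) :
    ∃ p : Fin 2 → ℝ, p ∈ stdSimplex ℝ (Fin 2) ∧ entropy p = h := by
  have l2 : 0 < Real.log 2 := Real.log_pos (by norm_num)
  obtain ⟨x, hx, e⟩ := intermediate_value_Icc (show (0 : ℝ) ≤ 2⁻¹ by norm_num)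
    Real.binEntropy_continuous.continuousOn (show h * Real.log 2 ∈ Set.Icc _ _ by
      rw [Real.binEntropy_zero, Real.binEntropy_two_inv]
      exact ⟨by positivity, by nlinarith⟩)
  have x2 := hx.2
  refine ⟨![x, 1 - x], ⟨?_, by simp⟩, ?_⟩
  · intro i
    fin_cases i
    · exact hx.1
    · simp; linarith
  · rw [Real.binEntropy_eq_negMulLog_add_negMulLog_one_sub, Real.negMulLog, Real.negMulLog] at e
    simp only [entropy, Fin.sum_univ_two, Matrix.cons_val_zero, Matrix.cons_val_one, Real.logb]
    field_simp
    linarith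

end BC

theorem mainTheorem2 :
    (∀ p ∈ stdSimplex ℝ (Fin 3), ∀ ε : ℝ, 0 < ε → ε ≤ BC.outInfo BC.blackwell p →
      BC.rateTriple BC.blackwell p ε ∈ BC.hanCostaRegion BC.blackwell) ∧
    ∃ ε₀ : ℝ, 0 < ε₀ ∧ ε₀ ≤ BC.outInfo BC.blackwell BC.unifInput ∧
      ∀ ε : ℝ, 0 < ε → ε < ε₀ →
        BC.rateTriple BC.blackwell BC.unifInput ε ∈ BC.hanCostaRegion BC.blackwell ∧
        ¬ BC.Achievable BC.blackwell (BC.rateTriple BC.blackwell BC.unifInput ε) ∧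
        (∃ (k a b : ℕ) (pK : Fin k → ℝ) (pS : Fin a → ℝ) (pT : Fin b → ℝ),
          pK ∈ stdSimplex ℝ (Fin k) ∧ pS ∈ stdSimplex ℝ (Fin a) ∧ pT ∈ stdSimplex ℝ (Fin b) ∧
          (BC.entropy pK, BC.entropy pS, BC.entropy pT) =
            BC.rateTriple BC.blackwell BC.unifInput ε) ∧
        ∀ (K S₀ T₀ : Type) [Fintype K] [Fintype S₀] [Fintype T₀]
          (pK : K → ℝ) (pS : S₀ → ℝ) (pT : T₀ → ℝ),
          pK ∈ stdSimplex ℝ K → pS ∈ stdSimplex ℝ S₀ → pT ∈ stdSimplex ℝ T₀ →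
          (BC.entropy pK, BC.entropy pS, BC.entropy pT) =
            BC.rateTriple BC.blackwell BC.unifInput ε →
          ¬ BC.Admissible BC.blackwell (BC.commonSource pK pS pT) := by
  -- The threshold is `I(Y₁; Y₂) / 7`, exactly where `7/6 R₀ + R₁ + R₂` falls to `log 3`.
  refine ⟨fun p hp ε => BC.rateTriple_mem_hanCostaRegion hp,
    (Real.logb 2 3 - 4 / 3) / 7, ?_, ?_, fun ε hε hε₀ => ?_⟩
  · linarith [BC.four_thirds_lt_logb]
  · rw [BC.outInfo_unifInput]
    linarith [BC.four_thirds_lt_logb]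
  have l₁ := BC.four_thirds_lt_logb
  have l₂ := BC.logb_two_three_lt
  refine ⟨BC.rateTriple_mem_hanCostaRegion ⟨fun _ => by norm_num [BC.unifInput], by
    norm_num [BC.unifInput]⟩ hε ?_, ?_, ?_, ?_⟩
  · rw [BC.outInfo_unifInput]
    linarith
  · rw [BC.rateTriple_unifInput]
    exact BC.not_achievable_blackwell (by dsimp only; linarith)
  · obtain ⟨pK, hK, eK⟩ := BC.exists_entropy_eq (h := Real.logb 2 3 - 4 / 3 - ε) (by linarith)
      (by linarith)
    obtain ⟨pS, hS, eS⟩ := BC.exists_entropy_eq (h := 2 / 3) (by norm_num) (by norm_num)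
    exact ⟨2, 2, 2, pK, pS, pS, hK, hS, hS, by rw [BC.rateTriple_unifInput, eK, eS]⟩
  · intro K S₀ T₀ _ _ _ pK pS pT hK hS hT e
    rw [BC.rateTriple_unifInput, Prod.mk.injEq, Prod.mk.injEq] at e
    obtain ⟨eK, eS, eT⟩ := e
    refine BC.not_admissible_blackwell hK hS hT ?_
    rw [eK, eS, eT]
    linarith
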